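/- Let $\mathbb{R}^{\mathbb{N}}$ be the set of real sequences $(x_1,x_2,\ldots)$ with its Borel $\sigma$-field $\mathcal{B}(\mathbb{R}^{\mathbb{N}})$, let $T(x_1,x_2,\ldots)=(x_2,x_3,\ldots)$ be the shift, and let $\mathbb{Q}$ be a stationary (that is, $T$-invariant) probability measure on $(\mathbb{R}^{\mathbb{N}},\mathcal{B}(\mathbb{R}^{\mathbb{N}}))$. Let $\mathcal{I}_{\mathbb{Q}}$ be the $\sigma$-field of almost invariant sets, i.e. of all $A\in\mathcal{B}(\mathbb{R}^{\mathbb{N}})$ with $\mathbb{Q}\big((A\setminus T^{-1}A)\cup(T^{-1}A\setminus A)\big)=0$. Let $Y$ be a real random variable on $(\mathbb{R}^{\mathbb{N}},\mathcal{B}(\mathbb{R}^{\mathbb{N}}),\mathbb{Q})$ and put $Y_i=Y\circ T^{i-1}$ for $i\ge 1$. Let $\gamma_1(Y|\mathcal{I}_{\mathbb{Q}})$ be (any version of) the conditional right endpoint of the support of $Y$ given $\mathcal{I}_{\mathbb{Q}}$, i.e. an $\mathcal{I}_{\mathbb{Q}}$-measurable $[-\infty,\infty]$-valued function $\gamma$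 such that $\mathbb{Q}(Y\le\gamma|\mathcal{I}_{\mathbb{Q}})=1$ a.s. and such that $\gamma\le g$ a.s. for every $\mathcal{I}_{\mathbb{Q}}$-measurable $[-\infty,\infty]$-valued $g$ with $\mathbb{Q}(Y\le g|\mathcal{I}_{\mathbb{Q}})=1$ a.s. Let $a>0$ be a real number and let $(k_n)_{n\ge1}$ be integers with $1\le k_n\le n$ for all $n$ and $k_n/n\to1$. Let $Y_{1:n}\le\cdots\le Y_{n:n}$ be the order statistics of $Y_1,\ldots,Y_n$, and let $$K^{\mathbb{Y}}(k_n,n,a)=\sum_{i=1}^n I\big(Y_{k_n:n}-a<Y_i<Y_{k_n:n}\big).$$ If $$\mathbb{Q}\big(Y=\gamma_1(Y|\mathcal{I}_{\mathbb{Q}})\big)=0\quad\text{and}\quad\mathbb{Q}\big(Y=\gamma_1(Y|\mathcal{I}_{\mathbb{Q}})-a\big)=0,$$ then, as $n\to\infty$, $$\frac{K^{\mathbb{Y}}(k_n,n,a)}{n}\longrightarrow\mathbb{Q}\big(Y>\gamma_1(Y|\mathcal{I}_{\mathbb{Q}})-a\,\big|\,\mathcal{I}_{\mathbb{Q}}\big)\qquad\mathbb{Q}\text{-almost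 surely}.$$ -/

import Mathlib

open MeasureTheory ProbabilityTheory Filter Topology

namespace NearMax

/-- The shift `(x₁, x₂, …) ↦ (x₂, x₃, …)` on real sequences; a sequence `(x₁, x₂, …)` is the
function `ℕ → ℝ` with `x_{j+1}` at index `j`. -/
def shift (x : ℕ → ℝ) : ℕ → ℝ := fun j => x (j + 1)

/-- The σ-field of those Borel sets `A` of sequences that are almost invariant for `Q`:
`A` and `T⁻¹A` differ by a `Q`-null set, `T` being the shift. -/
@[reducible]
def almostInvariant (Q : Measure (ℕ → ℝ)) : MeasurableSpace (ℕ → ℝ) where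
  MeasurableSet' A := MeasurableSet A ∧ Q ((A \ shift ⁻¹' A) ∪ (shift ⁻¹' A \ A)) = 0
  measurableSet_empty := by simp
  measurableSet_compl A hA := by
    refine ⟨hA.1.compl, ?_⟩
    convert hA.2 using 2
    ext x
    simp only [Set.mem_union, Set.mem_sdiff, Set.mem_preimage, Set.mem_compl_iff]
    tauto
  measurableSet_iUnion f hf := by
    refine ⟨MeasurableSet.iUnion fun i => (hf i).1, ?_⟩
    refine measure_mono_null ?_ (measure_iUnion_null fun i => (hf i).2)
    intro x hx
    simp only [Set.mem_union, Set.mem_sdiff, Set.mem_preimage, Set.mem_iUnion, not_exists] at hx ⊢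
    rcases hx with ⟨⟨i, hi⟩, h⟩ | ⟨⟨i, hi⟩, h⟩
    · exact ⟨i, Or.inl ⟨hi, h i⟩⟩
    · exact ⟨i, Or.inr ⟨hi, h i⟩⟩

theorem almostInvariant_le (Q : Measure (ℕ → ℝ)) :
    almostInvariant Q ≤ (inferInstance : MeasurableSpace (ℕ → ℝ)) :=
  fun _ hA => hA.1

/-- `γ` is a version of the conditional right endpoint of the support of the random variable `X`
given the sub-σ-field `𝒢`: the a.s. least `𝒢`-measurable extended random variable with
`P(X ≤ γ | 𝒢) = 1` a.s. -/
structure IsCondRightEndpoint {Ω : Type*} {m₀ : MeasurableSpace Ω} (P : Measure Ω) (X : Ω → ℝ)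
    (𝒢 : MeasurableSpace Ω) (γ : Ω → EReal) : Prop where
  sub_field : 𝒢 ≤ m₀
  measurable : Measurable[𝒢] γ
  le_endpoint : P⟦{ω | (X ω : EReal) ≤ γ ω} | 𝒢⟧ =ᵐ[P] fun _ => 1
  least : ∀ g : Ω → EReal, Measurable[𝒢] g →
    P⟦{ω | (X ω : EReal) ≤ g ω} | 𝒢⟧ =ᵐ[P] (fun _ => 1) → γ ≤ᵐ[P] g

/-- The `k`-th smallest `y_{k:n}` of the first `n` terms of `y`, for `1 ≤ k ≤ n`
(and `0` for other `k`). -/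
noncomputable def orderStat (y : ℕ → ℝ) (k n : ℕ) : ℝ :=
  if h : 1 ≤ k ∧ k ≤ n then
    (fun i : Fin n => y i) (Tuple.sort (fun i : Fin n => y i) ⟨k - 1, by omega⟩)
  else 0

/-- The number of the first `n` terms of `y` that lie in the open interval
`(y_{k:n} - a, y_{k:n})`. -/
noncomputable def nearCount (y : ℕ → ℝ) (k n : ℕ) (a : ℝ) : ℝ :=
  ∑ i ∈ Finset.range n, (Set.Ioo (orderStat y k n - a) (orderStat y k n)).indicator 1 (y i)

/-- The sequence `Y₁, Y₂, …` generated by `Y` along the shift, evaluated at the point `x`: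
index `i` holds `Y_{i+1}(x) = Y(x_{i+1}, x_{i+2}, …)`. -/
def shiftSeq (Y : (ℕ → ℝ) → ℝ) (x : ℕ → ℝ) : ℕ → ℝ := fun i => Y (shift^[i] x)

end NearMax

/-!
By the pointwise ergodic theorem, almost surely the frequency of visits of `Y₁, Y₂, …` to `(q, ∞)`
converges to `κ (q, ∞)` for every rational `q`, where `κ` is the conditional law of `Y`.
The endpoint `γ` is almost surely constant along orbits, so `Yᵢ ≤ γ` for all `i`. A rational `q < γ`
has `κ (q, ∞) > 0`, while only a proportion `1 - kₙ/n → 0` of the terms can exceed the order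
statistic, so the order statistic eventually exceeds `q`; hence it tends to `γ`. The proportion of
terms in the window below it is then squeezed between `κ (q', ∞) - κ (q, ∞)` and `κ (p, ∞)` for
rational `q' > γ - a`, `q < γ` and `p < γ - a`, and `κ` has no atoms at `γ` and `γ - a`.

For the ergodic theorem, let `g` have integral zero over every invariant set. Where the Birkhoff
sums of `g - ε` are unbounded, which is an invariant set, the maximal inequality makes the integral
of `g - ε` nonnegative; as that integral is `-ε` times the measure of the set, the set is null, and
the averages of `g` are eventually below `2 ε`.
-/

namespace NearMax

section ErgodicTheorem

variable {Ω : Type*} {𝒢 m₀ : MeasurableSpace Ω} {μ : Measure Ω} {T : Ω → Ω} {g h : Ω → ℝ}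

/-- The largest of the Birkhoff sums of `h` with at most `N` terms, the empty sum included. -/
noncomputable def birkhoffMax (T : Ω → Ω) (h : Ω → ℝ) (N : ℕ) (x : Ω) : ℝ :=
  partialSups (fun n => birkhoffSum T h n x) N

theorem birkhoffMax_succ (N : ℕ) :
    birkhoffMax T h (N + 1) = fun x => max 0 (h x + birkhoffMax T h N (T x)) := by
  funext x
  simp only [birkhoffMax, partialSups_add_one', ← partialSups_const_add]
  simp only [Function.comp_def, birkhoffSum_succ']
  rfl

theorem monotone_birkhoffMax (x : Ω) : Monotone fun N => birkhoffMax T h N x :=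
  (partialSups fun n => birkhoffSum T h n x).monotone

theorem birkhoffMax_nonneg (N : ℕ) (x : Ω) : 0 ≤ birkhoffMax T h N x :=
  monotone_birkhoffMax x N.zero_le

theorem birkhoffMax_sub_comp_le (N : ℕ) (x : Ω) :
    birkhoffMax T h N x - birkhoffMax T h N (T x) ≤
      {x | 0 < birkhoffMax T h N x}.indicator h x := by
  by_cases hx : 0 < birkhoffMax T h N x
  · have hle := monotone_birkhoffMax (T := T) (h := h) x N.le_succ
    simp only [Nat.succ_eq_add_one, birkhoffMax_succ, le_max_iff, hx.not_ge, false_or] at hle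
    rw [Set.indicator_of_mem (by exact hx)]
    linarith
  · rw [Set.indicator_of_notMem (by exact hx)]
    linarith [birkhoffMax_nonneg (T := T) (h := h) N (T x)]

theorem measurable_birkhoffSum (hT : Measurable T) (hh : Measurable h) (n : ℕ) :
    Measurable (birkhoffSum T h n) :=
  Finset.measurable_fun_sum _ fun i _ => hh.comp (hT.iterate i)

theorem measurable_birkhoffMax (hT : Measurable T) (hh : Measurable h) (N : ℕ) :
    Measurable (birkhoffMax T h N) := by
  induction N with
  | zero => exact measurable_const
  | succ N ih =>
    rw [birkhoffMax_succ]
    exact measurable_const.max (hh.add (ih.comp hT))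

theorem integrable_birkhoffMax (hT : MeasurePreserving T μ μ) (hi : Integrable h μ) (N : ℕ) :
    Integrable (birkhoffMax T h N) μ := by
  induction N with
  | zero => exact integrable_zero ..
  | succ N ih =>
    rw [birkhoffMax_succ]
    exact (integrable_zero ..).sup (hi.add (hT.integrable_comp_of_integrable ih))

theorem setIntegral_birkhoffMax_pos_nonneg (hT : MeasurePreserving T μ μ) (hh : Measurable h)
    (hi : Integrable h μ) (N : ℕ) : 0 ≤ ∫ x in {x | 0 < birkhoffMax T h N x}, h x ∂μ := by
  have hM := measurable_birkhoffMax hT.measurable hh N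
  have hMi := integrable_birkhoffMax hT hi N
  have hMTi := hT.integrable_comp_of_integrable hMi
  have hpos : MeasurableSet {x | 0 < birkhoffMax T h N x} := measurableSet_lt measurable_const hM
  calc (0 : ℝ) = ∫ x, birkhoffMax T h N x ∂μ - ∫ x, birkhoffMax T h N (T x) ∂μ := by
        rw [← integral_map hT.aemeasurable hM.aestronglyMeasurable, hT.map_eq, sub_self]
    _ = ∫ x, (birkhoffMax T h N x - birkhoffMax T h N (T x)) ∂μ :=
        (integral_sub hMi hMTi).symm
    _ ≤ ∫ x, {x | 0 < birkhoffMax T h N x}.indicator h x ∂μ :=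
        integral_mono (hMi.sub hMTi) (hi.indicator hpos) (birkhoffMax_sub_comp_le N)
    _ = ∫ x in {x | 0 < birkhoffMax T h N x}, h x ∂μ := integral_indicator hpos

theorem integral_nonneg_of_ae_exists_birkhoffSum_pos (hT : MeasurePreserving T μ μ)
    (hh : Measurable h) (hi : Integrable h μ) (hpos : ∀ᵐ x ∂μ, ∃ n, 0 < birkhoffSum T h n x) :
    0 ≤ ∫ x, h x ∂μ := by
  have huniv : ⋃ N, {x | 0 < birkhoffMax T h N x} =ᵐ[μ] Set.univ := by
    refine eventuallyEq_univ.2 ?_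
    filter_upwards [hpos] with x ⟨n, hn⟩
    exact Set.mem_iUnion.2 ⟨n, hn.trans_le (le_partialSups (fun n => birkhoffSum T h n x) n)⟩
  rw [← setIntegral_univ, ← setIntegral_congr_set huniv]
  exact ge_of_tendsto' (tendsto_setIntegral_of_monotone
    (fun N => measurableSet_lt measurable_const (measurable_birkhoffMax hT.measurable hh N))
    (fun _ _ hMN x hx => hx.trans_le (monotone_birkhoffMax x hMN)) hi.integrableOn)
    (setIntegral_birkhoffMax_pos_nonneg hT hh hi)

theorem measurableSet_invariants_bddAbove_birkhoffSum (hT : Measurable T) (hh : Measurable h) :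
    MeasurableSet[.invariants T] {x | BddAbove (Set.range fun n => birkhoffSum T h n x)} := by
  refine MeasurableSpace.measurableSet_invariants.2
    ⟨measurableSet_bddAbove_range (measurable_birkhoffSum hT hh), ?_⟩
  ext x
  simp only [Set.mem_preimage, Set.mem_ofPred_eq, bddAbove_def, Set.forall_mem_range]
  constructor
  · rintro ⟨C, hC⟩
    refine ⟨max 0 (h x + C), fun n => ?_⟩
    cases n with
    | zero => exact le_max_left ..
    | succ n =>
      rw [birkhoffSum_succ']
      exact le_max_of_le_right (add_le_add_right (hC n) _)
  · rintro ⟨C, hC⟩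
    refine ⟨C - h x, fun n => ?_⟩
    have := hC (n + 1)
    rw [birkhoffSum_succ'] at this
    linarith

theorem ae_bddAbove_birkhoffSum (hT : MeasurePreserving T μ μ) (hh : Measurable h)
    (hi : Integrable h μ)
    (hneg : ∀ B, MeasurableSet[.invariants T] B → μ B ≠ 0 → ∫ x in B, h x ∂μ < 0) :
    ∀ᵐ x ∂μ, BddAbove (Set.range fun n => birkhoffSum T h n x) := by
  set U := {x | BddAbove (Set.range fun n => birkhoffSum T h n x)}ᶜ
  have hU : MeasurableSet[.invariants T] U :=
    (measurableSet_invariants_bddAbove_birkhoffSum hT.measurable hh).compl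
  obtain ⟨hUm, hUT⟩ := MeasurableSpace.measurableSet_invariants.1 hU
  have hTU : MeasurePreserving T (μ.restrict U) (μ.restrict U) := by
    simpa only [hUT] using hT.restrict_preimage hUm
  have hpos : ∀ᵐ x ∂μ.restrict U, ∃ n, 0 < birkhoffSum T h n x := by
    filter_upwards [ae_restrict_mem hUm] with x hx
    simpa using not_bddAbove_iff.1 hx 0
  by_contra hne
  exact (hneg U hU hne).not_ge
    (integral_nonneg_of_ae_exists_birkhoffSum_pos hTU hh hi.integrableOn hpos)

theorem ae_forall_iterate_eq {β : Type*} [MeasurableSpace β] [MeasurableSpace.CountablySeparated β]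
    (hT : MeasurePreserving T μ μ) (hinv : ∀ A, MeasurableSet[𝒢] A → T ⁻¹' A =ᵐ[μ] A)
    {f : Ω → β} (hf : Measurable[𝒢] f) : ∀ᵐ x ∂μ, ∀ n, f (T^[n] x) = f x := by
  have hfT : f ∘ T =ᵐ[μ] f :=
    .of_forall_separating_preimage MeasurableSet fun U hU => hinv _ (hf hU)
  filter_upwards [ae_all_iff.2 fun n => (hT.iterate n).quasiMeasurePreserving.ae hfT] with x hx n
  induction n with
  | zero => rfl
  | succ n ih => rw [Function.iterate_succ_apply', ← ih]; exact hx n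

variable [IsFiniteMeasure μ]

theorem ae_eventually_birkhoffAverage_lt (hT : MeasurePreserving T μ μ) (hg : Measurable g)
    (hgi : Integrable g μ) (hint : ∀ B, MeasurableSet[.invariants T] B → ∫ x in B, g x ∂μ = 0)
    {ε : ℝ} (hε : 0 < ε) : ∀ᵐ x ∂μ, ∀ᶠ n in atTop, birkhoffAverage ℝ T g n x < ε := by
  have hbdd := ae_bddAbove_birkhoffSum hT (h := fun x => g x - ε / 2) (hg.sub_const _)
    (hgi.sub (integrable_const _)) fun B hB hB0 => by
      rw [integral_sub hgi.integrableOn (integrable_const _), hint B hB, setIntegral_const,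
        smul_eq_mul, zero_sub, neg_lt_zero]
      exact mul_pos (ENNReal.toReal_pos hB0 (measure_ne_top μ B)) (half_pos hε)
  filter_upwards [hbdd] with x ⟨C, hC⟩
  have hlim : Tendsto (fun n : ℕ => C / n + ε / 2) atTop (𝓝 (0 + ε / 2)) :=
    (tendsto_const_div_atTop_nhds_zero_nat C).add_const _
  filter_upwards [hlim.eventually_lt_const (u := ε) (by linarith), eventually_gt_atTop 0]
    with n hn hn0
  have hn0' : (0 : ℝ) < n := Nat.cast_pos.2 hn0
  have hCn : birkhoffSum T g n x ≤ C + n * (ε / 2) := by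
    have : birkhoffSum T (fun x => g x - ε / 2) n x ≤ C := hC ⟨n, rfl⟩
    simpa [birkhoffSum, Finset.sum_sub_distrib] using this
  calc birkhoffAverage ℝ T g n x ≤ (n : ℝ)⁻¹ * (C + n * (ε / 2)) :=
        mul_le_mul_of_nonneg_left hCn (inv_nonneg.2 hn0'.le)
    _ = C / n + ε / 2 := by field_simp
    _ < ε := hn

theorem ae_tendsto_birkhoffAverage_zero (hT : MeasurePreserving T μ μ) (hg : Measurable g)
    (hgi : Integrable g μ) (hint : ∀ B, MeasurableSet[.invariants T] B → ∫ x in B, g x ∂μ = 0) :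
    ∀ᵐ x ∂μ, Tendsto (fun n => birkhoffAverage ℝ T g n x) atTop (𝓝 0) := by
  have hneg : ∀ B, MeasurableSet[.invariants T] B → ∫ x in B, (-g) x ∂μ = 0 := fun B hB => by
    simp only [Pi.neg_apply, integral_neg, hint B hB, neg_zero]
  have hupper := ae_all_iff.2 fun m : ℕ =>
    ae_eventually_birkhoffAverage_lt hT hg hgi hint (Nat.one_div_pos_of_nat (n := m))
  have hlower := ae_all_iff.2 fun m : ℕ =>
    ae_eventually_birkhoffAverage_lt hT hg.neg hgi.neg hneg (Nat.one_div_pos_of_nat (n := m))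
  filter_upwards [hupper, hlower] with x hu hl
  refine Metric.nhds_basis_ball_inv_nat_succ.tendsto_right_iff.2 fun m _ => ?_
  filter_upwards [hu m, hl m] with n hun hln
  rw [birkhoffAverage_neg] at hln
  rw [mem_ball_zero_iff, Real.norm_eq_abs, abs_lt]
  exact ⟨neg_lt.1 hln, hun⟩

theorem ae_tendsto_birkhoffAverage_condExp_of_measurable (hT : MeasurePreserving T μ μ)
    (h𝒢 : 𝒢 ≤ m₀) (hle : MeasurableSpace.invariants T ≤ 𝒢)
    (hinv : ∀ A, MeasurableSet[𝒢] A → T ⁻¹' A =ᵐ[μ] A) (hg : Measurable g)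
    (hgi : Integrable g μ) :
    ∀ᵐ x ∂μ, Tendsto (fun n => birkhoffAverage ℝ T g n x) atTop (𝓝 ((μ[g | 𝒢]) x)) := by
  have hcm : Measurable[𝒢] (μ[g | 𝒢]) := stronglyMeasurable_condExp.measurable
  have hzero := ae_tendsto_birkhoffAverage_zero hT (hg.sub (hcm.mono h𝒢 le_rfl))
    (hgi.sub integrable_condExp) fun B hB => by
      simp only [Pi.sub_apply]
      rw [integral_sub hgi.integrableOn integrable_condExp.integrableOn,
        setIntegral_condExp h𝒢 hgi (hle B hB), sub_self]
  filter_upwards [hzero, ae_forall_iterate_eq hT hinv hcm] with x hx hc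
  have hlim := hx.add_const ((μ[g | 𝒢]) x)
  rw [zero_add] at hlim
  refine hlim.congr' ?_
  filter_upwards [eventually_ne_atTop 0] with n hn
  have hconst : birkhoffAverage ℝ T (μ[g | 𝒢]) n x = (μ[g | 𝒢]) x := by
    have hn' : (n : ℝ) ≠ 0 := Nat.cast_ne_zero.2 hn
    simp only [birkhoffAverage, birkhoffSum, hc, Finset.sum_const, Finset.card_range,
      nsmul_eq_mul, smul_eq_mul, inv_mul_cancel_left₀ hn']
  rw [birkhoffAverage_sub, Pi.sub_apply, Pi.sub_apply, hconst, sub_add_cancel]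

theorem ae_tendsto_birkhoffAverage_condExp (hT : MeasurePreserving T μ μ)
    (h𝒢 : 𝒢 ≤ m₀) (hle : MeasurableSpace.invariants T ≤ 𝒢)
    (hinv : ∀ A, MeasurableSet[𝒢] A → T ⁻¹' A =ᵐ[μ] A) (hgi : Integrable g μ) :
    ∀ᵐ x ∂μ, Tendsto (fun n => birkhoffAverage ℝ T g n x) atTop (𝓝 ((μ[g | 𝒢]) x)) := by
  have hmk := hgi.1.ae_eq_mk
  filter_upwards [ae_all_iff.2
      (hT.quasiMeasurePreserving.birkhoffAverage_ae_eq_of_ae_eq ℝ hmk), condExp_congr_ae hmk,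
    ae_tendsto_birkhoffAverage_condExp_of_measurable hT h𝒢 hle hinv
      hgi.1.stronglyMeasurable_mk.measurable (hgi.congr hmk)] with x havg hcond hlim
  rw [hcond]
  exact hlim.congr fun n => (havg n).symm

end ErgodicTheorem

section VisitFrequencies

variable {y : ℕ → ℝ} {k : ℕ → ℕ} {n : ℕ} {s t : Set ℝ}

/-- The proportion of the first `n` terms of `y` that lie in `s` (and `0` for `n = 0`). -/
noncomputable def visitFreq (y : ℕ → ℝ) (s : Set ℝ) (n : ℕ) : ℝ :=
  (∑ i ∈ Finset.range n, s.indicator 1 (y i)) / n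

theorem nearCount_div_eq_visitFreq (y : ℕ → ℝ) (k n : ℕ) (a : ℝ) :
    nearCount y k n a / n =
      visitFreq y (Set.Ioo (orderStat y k n - a) (orderStat y k n)) n := rfl

theorem birkhoffAverage_indicator_eq_visitFreq {Ω : Type*} (T : Ω → Ω) (Y : Ω → ℝ) (s : Set ℝ)
    (n : ℕ) (x : Ω) :
    birkhoffAverage ℝ T ((Y ⁻¹' s).indicator 1) n x = visitFreq (fun i => Y (T^[i] x)) s n := by
  simp only [birkhoffAverage, birkhoffSum, visitFreq, div_eq_inv_mul, smul_eq_mul]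
  rfl

theorem visitFreq_nonneg : 0 ≤ visitFreq y s n :=
  div_nonneg (Finset.sum_nonneg fun _ _ => Set.indicator_nonneg (fun _ _ => zero_le_one) _)
    n.cast_nonneg

theorem visitFreq_mono (hst : s ⊆ t) : visitFreq y s n ≤ visitFreq y t n :=
  div_le_div_of_nonneg_right (Finset.sum_le_sum fun _ _ =>
    Set.indicator_le_indicator_of_subset hst (fun _ => zero_le_one) _) n.cast_nonneg

theorem visitFreq_union_le : visitFreq y (s ∪ t) n ≤ visitFreq y s n + visitFreq y t n := by
  rw [visitFreq, visitFreq, visitFreq, ← add_div, ← Finset.sum_add_distrib]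
  refine div_le_div_of_nonneg_right (Finset.sum_le_sum fun i _ => ?_) n.cast_nonneg
  rw [← Set.indicator_union_add_inter_apply]
  exact le_add_of_nonneg_right (Set.indicator_nonneg (fun _ _ => zero_le_one) _)

theorem exists_orderStat_eq {m : ℕ} (hm : 1 ≤ m ∧ m ≤ n) : ∃ i, orderStat y m n = y i := by
  rw [orderStat, dif_pos hm]
  exact ⟨_, rfl⟩

theorem sum_indicator_Ioi_le_of_orderStat_le {m : ℕ} (hm : 1 ≤ m ∧ m ≤ n) {c : ℝ}
    (hc : orderStat y m n ≤ c) :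
    ∑ i ∈ Finset.range n, (Set.Ioi c).indicator (1 : ℝ → ℝ) (y i) ≤ n - m := by
  rw [orderStat, dif_pos hm] at hc
  set f : Fin n → ℝ := fun i => y i
  set j₀ : Fin n := ⟨m - 1, by omega⟩
  have hmono : Monotone (f ∘ Tuple.sort f) := Tuple.monotone_sort f
  have hcard : (Finset.Ioi j₀).card = n - m := by
    rw [Fin.card_Ioi]
    simp only [j₀]
    omega
  calc ∑ i ∈ Finset.range n, (Set.Ioi c).indicator (1 : ℝ → ℝ) (y i)
      = ∑ i : Fin n, (Set.Ioi c).indicator (1 : ℝ → ℝ) (f i) :=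
        Finset.sum_range fun i => (Set.Ioi c).indicator (1 : ℝ → ℝ) (y i)
    _ = ∑ j : Fin n, (Set.Ioi c).indicator (1 : ℝ → ℝ) (f (Tuple.sort f j)) :=
        (Equiv.sum_comp (Tuple.sort f) _).symm
    _ ≤ ∑ j : Fin n, if j ∈ Finset.Ioi j₀ then (1 : ℝ) else 0 := by
        refine Finset.sum_le_sum fun j _ => ?_
        split_ifs with hj
        · exact Set.indicator_le_self' (fun _ _ => zero_le_one) _
        · rw [Finset.mem_Ioi, not_lt] at hj
          exact (Set.indicator_of_notMem ((hmono hj).trans hc).not_gt _).le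
    _ = n - m := by
        rw [Finset.sum_ite_mem, Finset.univ_inter, Finset.sum_const, nsmul_one, hcard,
          Nat.cast_sub hm.2]

theorem visitFreq_Ioi_le_of_orderStat_le {m : ℕ} (hm : 1 ≤ m ∧ m ≤ n) {c : ℝ}
    (hc : orderStat y m n ≤ c) : visitFreq y (Set.Ioi c) n ≤ 1 - m / n := by
  have hn : (n : ℝ) ≠ 0 := Nat.cast_ne_zero.2 (by omega)
  rw [one_sub_div hn]
  exact div_le_div_of_nonneg_right (sum_indicator_Ioi_le_of_orderStat_le hm hc) n.cast_nonneg

theorem eventually_lt_orderStat (hk : ∀ᶠ n in atTop, 1 ≤ k n ∧ k n ≤ n)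
    (hk_lim : Tendsto (fun n => (k n : ℝ) / n) atTop (𝓝 1)) {c p : ℝ} (hp : 0 < p)
    (hfreq : Tendsto (visitFreq y (Set.Ioi c)) atTop (𝓝 p)) :
    ∀ᶠ n in atTop, c < orderStat y (k n) n := by
  have h0 : Tendsto (fun n => 1 - (k n : ℝ) / n) atTop (𝓝 0) := by
    simpa only [sub_self] using hk_lim.const_sub 1
  filter_upwards [h0.eventually_lt hfreq hp, hk] with n hn hkn
  by_contra! hle
  exact hn.not_ge (visitFreq_Ioi_le_of_orderStat_le hkn hle)

end VisitFrequencies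

section Deterministic

variable {y : ℕ → ℝ} {k : ℕ → ℕ} {ν : Measure ℝ} [IsFiniteMeasure ν]

theorem exists_rat_lt_measureReal_Ioi_lt {w : EReal} (hw : w ≠ ⊥) {b : ℝ}
    (hb : ν.real {r | w ≤ r} < b) :
    ∃ q : ℚ, ((q : ℝ) : EReal) < w ∧ ν.real (Set.Ioi (q : ℝ)) < b := by
  obtain ⟨q₀, -, hq₀⟩ := EReal.lt_iff_exists_rat_btwn.1 (bot_lt_iff_ne_bot.2 hw)
  have hInter : {r : ℝ | w ≤ r} = ⋂ q : {q : ℚ // ((q : ℝ) : EReal) < w}, Set.Ioi (q : ℝ) := by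
    ext r
    simp only [Set.mem_ofPred_eq, Set.mem_iInter, Subtype.forall, Set.mem_Ioi]
    refine ⟨fun h q hq => EReal.coe_lt_coe_iff.1 (hq.trans_le h), fun h => ?_⟩
    by_contra! hlt
    obtain ⟨q, hrq, hqw⟩ := EReal.lt_iff_exists_rat_btwn.1 hlt
    exact (EReal.coe_lt_coe_iff.1 hrq).not_gt (h q hqw)
  have hdir : Antitone fun q : {q : ℚ // ((q : ℝ) : EReal) < w} => Set.Ioi (q : ℝ) :=
    fun _ _ hqr => Set.Ioi_subset_Ioi (Rat.cast_le.2 hqr)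
  have : Nonempty {q : ℚ // ((q : ℝ) : EReal) < w} := ⟨⟨q₀, hq₀⟩⟩
  rw [Measure.real, ← ENNReal.lt_ofReal_iff_toReal_lt (measure_ne_top ν _), hInter,
    hdir.directed_ge.measure_iInter (fun _ => measurableSet_Ioi.nullMeasurableSet)
      ⟨⟨q₀, hq₀⟩, measure_ne_top ν _⟩, iInf_lt_iff] at hb
  obtain ⟨⟨q, hq⟩, hqb⟩ := hb
  exact ⟨q, hq, (ENNReal.lt_ofReal_iff_toReal_lt (measure_ne_top ν _)).1 hqb⟩

theorem exists_rat_gt_lt_measureReal_Ioi {w : EReal} {b : ℝ} (hb₀ : 0 ≤ b)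
    (hb : b < ν.real {r | w < r}) :
    ∃ q : ℚ, w < ((q : ℝ) : EReal) ∧ b < ν.real (Set.Ioi (q : ℝ)) := by
  have hUnion : {r : ℝ | w < r} = ⋃ q : {q : ℚ // w < ((q : ℝ) : EReal)}, Set.Ioi (q : ℝ) := by
    ext r
    simp only [Set.mem_ofPred_eq, Set.mem_iUnion, Subtype.exists, Set.mem_Ioi, exists_prop]
    refine ⟨fun h => ?_, fun ⟨q, hwq, hqr⟩ => hwq.trans (EReal.coe_lt_coe_iff.2 hqr)⟩
    obtain ⟨q, hwq, hqr⟩ := EReal.lt_iff_exists_rat_btwn.1 h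
    exact ⟨q, hwq, EReal.coe_lt_coe_iff.1 hqr⟩
  have hdir : Antitone fun q : {q : ℚ // w < ((q : ℝ) : EReal)} => Set.Ioi (q : ℝ) :=
    fun _ _ hqr => Set.Ioi_subset_Ioi (Rat.cast_le.2 hqr)
  rw [Measure.real, ← ENNReal.ofReal_lt_iff_lt_toReal hb₀ (measure_ne_top ν _), hUnion,
    hdir.directed_le.measure_iUnion, lt_iSup_iff] at hb
  obtain ⟨⟨q, hq⟩, hqb⟩ := hb
  exact ⟨q, hq, (ENNReal.ofReal_lt_iff_lt_toReal hb₀ (measure_ne_top ν _)).1 hqb⟩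

theorem eventually_nearCount_div_lt {a b : ℝ} {z : EReal} (hz : z ≠ ⊥)
    (hlt : ∀ q : ℚ, ((q : ℝ) : EReal) < z → ∀ᶠ n in atTop, (q : ℝ) < orderStat y (k n) n)
    (hfreq : ∀ q : ℚ, Tendsto (visitFreq y (Set.Ioi (q : ℝ))) atTop
      (𝓝 (ν.real (Set.Ioi (q : ℝ)))))
    (hb : ν.real {r | z - a ≤ (r : EReal)} < b) :
    ∀ᶠ n in atTop, nearCount y (k n) n a / n < b := by
  have hza : z - a ≠ ⊥ := by
    simpa [sub_eq_add_neg, EReal.add_eq_bot_iff, ← EReal.coe_neg] using hz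
  obtain ⟨q, hq, hqb⟩ := exists_rat_lt_measureReal_Ioi_lt hza hb
  obtain ⟨q', hqq', hq'⟩ := EReal.lt_iff_exists_rat_btwn.1 (EReal.add_lt_of_lt_sub hq)
  filter_upwards [hlt q' hq', (hfreq q).eventually_lt_const hqb] with n hn hnb
  refine (visitFreq_mono fun r hr => ?_).trans_lt hnb
  have : (q : ℝ) + a < q' := by exact_mod_cast hqq'
  simp only [Set.mem_Ioi]
  linarith [hr.1]

theorem eventually_lt_nearCount_div {a b : ℝ} {z : EReal} (hz : z ≠ ⊥)
    (hle : ∀ᶠ n in atTop, (orderStat y (k n) n : EReal) ≤ z)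
    (hlt : ∀ q : ℚ, ((q : ℝ) : EReal) < z → ∀ᶠ n in atTop, (q : ℝ) < orderStat y (k n) n)
    (hνz : ν {r | z ≤ (r : EReal)} = 0)
    (hfreq : ∀ q : ℚ, Tendsto (visitFreq y (Set.Ioi (q : ℝ))) atTop
      (𝓝 (ν.real (Set.Ioi (q : ℝ)))))
    (hb₀ : 0 ≤ b) (hb : b < ν.real {r | z - a < (r : EReal)}) :
    ∀ᶠ n in atTop, b < nearCount y (k n) n a / n := by
  obtain ⟨q', hzq', hbq'⟩ := exists_rat_gt_lt_measureReal_Ioi hb₀ hb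
  obtain ⟨q, hqz, hq⟩ : ∃ q : ℚ, ((q : ℝ) : EReal) < z ∧
      ν.real (Set.Ioi (q : ℝ)) < ν.real (Set.Ioi (q' : ℝ)) - b :=
    exists_rat_lt_measureReal_Ioi_lt hz (by simpa [Measure.real, hνz] using hbq')
  filter_upwards [hle, hlt q hqz,
    ((hfreq q').sub (hfreq q)).eventually_const_lt (lt_sub_comm.1 hq)] with n hnz hqn hn
  have hsub : Set.Ioi (q' : ℝ) ⊆
      Set.Ioo (orderStat y (k n) n - a) (orderStat y (k n) n) ∪ Set.Ioi (q : ℝ) := by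
    intro r hr
    have hlow : orderStat y (k n) n - a < q' := by
      exact_mod_cast (EReal.sub_le_sub hnz le_rfl).trans_lt hzq'
    exact (lt_or_ge r (orderStat y (k n) n)).imp (fun h => ⟨hlow.trans hr, h⟩) hqn.trans_le
  have := (visitFreq_mono (y := y) (n := n) hsub).trans visitFreq_union_le
  rw [nearCount_div_eq_visitFreq]
  linarith

theorem tendsto_nearCount_div {a : ℝ} {z : EReal} (hk : ∀ᶠ n in atTop, 1 ≤ k n ∧ k n ≤ n)
    (hk_lim : Tendsto (fun n => (k n : ℝ) / n) atTop (𝓝 1)) (hy : ∀ i, (y i : EReal) ≤ z)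
    (hfreq : ∀ q : ℚ, Tendsto (visitFreq y (Set.Ioi (q : ℝ))) atTop
      (𝓝 (ν.real (Set.Ioi (q : ℝ)))))
    (hpos : ∀ q : ℚ, ((q : ℝ) : EReal) < z → 0 < ν.real (Set.Ioi (q : ℝ)))
    (hνz : ν {r | z ≤ (r : EReal)} = 0) (hνza : ν {r | (r : EReal) = z - a} = 0) :
    Tendsto (fun n => nearCount y (k n) n a / n) atTop (𝓝 (ν.real {r | z - a < (r : EReal)})) := by
  have hz : z ≠ ⊥ := ((EReal.bot_lt_coe _).trans_le (hy 0)).ne'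
  have hle : ∀ᶠ n in atTop, (orderStat y (k n) n : EReal) ≤ z := by
    filter_upwards [hk] with n hn
    obtain ⟨i, hi⟩ := exists_orderStat_eq (y := y) hn
    exact hi ▸ hy i
  have hlt (q : ℚ) (hq : ((q : ℝ) : EReal) < z) : ∀ᶠ n in atTop, (q : ℝ) < orderStat y (k n) n :=
    eventually_lt_orderStat hk hk_lim (hpos q hq) (hfreq q)
  refine tendsto_order.2 ⟨fun b hb => ?_, fun b hb => ?_⟩
  · rcases lt_or_ge b 0 with hb₀ | hb₀
    · exact .of_forall fun n => hb₀.trans_le visitFreq_nonneg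
    · exact eventually_lt_nearCount_div hz hle hlt hνz hfreq hb₀ hb
  · refine eventually_nearCount_div_lt hz hlt hfreq (hb.trans_le' ?_)
    have hsplit : {r : ℝ | z - a ≤ (r : EReal)} ⊆
        {r : ℝ | z - a < (r : EReal)} ∪ {r : ℝ | (r : EReal) = z - a} :=
      fun r hr => (lt_or_eq_of_le (show z - a ≤ r from hr)).imp id Eq.symm
    calc ν.real {r | z - a ≤ (r : EReal)}
        ≤ ν.real {r | z - a < (r : EReal)} + ν.real {r | (r : EReal) = z - a} :=
          (measureReal_mono hsplit).trans (measureReal_union_le ..)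
      _ = ν.real {r | z - a < (r : EReal)} := by simp [Measure.real, hνza]

end Deterministic

section ConditionalProbability

variable {Ω : Type*} {𝒢 m₀ : MeasurableSpace Ω} {P : Measure Ω}

theorem condProb_congr {A B : Set Ω} (hAB : A =ᵐ[P] B) : P⟦A | 𝒢⟧ =ᵐ[P] P⟦B | 𝒢⟧ :=
  condExp_congr_ae (indicator_ae_eq_of_ae_eq_set hAB)

variable [IsFiniteMeasure P]

theorem condProb_ae_eq_one_iff (h𝒢 : 𝒢 ≤ m₀) {A : Set Ω} (hA : MeasurableSet A) :
    P⟦A | 𝒢⟧ =ᵐ[P] (fun _ => 1) ↔ ∀ᵐ x ∂P, x ∈ A := by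
  constructor
  · intro h
    have hreal : P.real A = P.real Set.univ := by
      calc P.real A = ∫ x, (P⟦A | 𝒢⟧) x ∂P := by
            rw [integral_condExp h𝒢, integral_indicator_const _ hA, smul_eq_mul, mul_one]
        _ = P.real Set.univ := by rw [integral_congr_ae h, integral_const, smul_eq_mul, mul_one]
    exact (ae_iff_measure_eq (p := (· ∈ A)) hA.nullMeasurableSet).2
      ((measureReal_eq_measureReal_iff (measure_ne_top P _) (measure_ne_top P _)).1 hreal)
  · intro h
    refine (condProb_congr (eventuallyEq_univ.2 h)).trans ?_
    rw [Set.indicator_univ, condExp_const h𝒢]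

theorem condProb_ae_eq_zero (h𝒢 : 𝒢 ≤ m₀) {A : Set Ω} (hA : P A = 0) :
    P⟦A | 𝒢⟧ =ᵐ[P] fun _ => 0 := by
  refine (condProb_congr (ae_eq_empty.2 hA)).trans ?_
  rw [Set.indicator_empty, condExp_const h𝒢]

theorem ae_condProb_pos_of_mem (h𝒢 : 𝒢 ≤ m₀) {A : Set Ω} (hA : MeasurableSet A) :
    ∀ᵐ x ∂P, x ∈ A → 0 < (P⟦A | 𝒢⟧) x := by
  set N : Set Ω := {x | (P⟦A | 𝒢⟧) x ≤ 0}
  have hN : MeasurableSet[𝒢] N :=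
    @measurableSet_le _ _ _ _ _ 𝒢 _ _ _ _ _ stronglyMeasurable_condExp.measurable
      measurable_const
  have hreal : P.real (N ∩ A) ≤ 0 := by
    calc P.real (N ∩ A) = ∫ x in N, A.indicator (fun _ => (1 : ℝ)) x ∂P := by
          rw [setIntegral_indicator hA, setIntegral_const, smul_eq_mul, mul_one]
      _ = ∫ x in N, (P⟦A | 𝒢⟧) x ∂P :=
          (setIntegral_condExp h𝒢 ((integrable_const 1).indicator hA) hN).symm
      _ ≤ 0 := setIntegral_nonpos (h𝒢 _ hN) fun _ hx => hx
  have hnull : P (N ∩ A) = 0 :=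
    (measureReal_eq_zero_iff (measure_ne_top P _)).1 (hreal.antisymm measureReal_nonneg)
  filter_upwards [measure_eq_zero_iff_ae_notMem.1 hnull] with x hx hxA
  exact not_le.1 fun hle => hx ⟨hle, hxA⟩

theorem condProb_preimage_ae_eq_condDistrib {β E : Type*} [MeasurableSpace β] [MeasurableSpace E]
    [StandardBorelSpace E] [Nonempty E] {X : Ω → β} {Y : Ω → E} (hX : Measurable X)
    (hY : Measurable Y) {S : Set (β × E)} (hS : MeasurableSet S) :
    P⟦(fun x => (X x, Y x)) ⁻¹' S | MeasurableSpace.comap X inferInstance⟧ =ᵐ[P]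
      fun x => (condDistrib Y X P (X x)).real {r | (X x, r) ∈ S} := by
  have hint := condExp_prod_ae_eq_integral_condDistrib (μ := P) hX hY.aemeasurable
    (stronglyMeasurable_one.indicator hS : StronglyMeasurable (S.indicator (1 : β × E → ℝ)))
    ((integrable_const (1 : ℝ)).indicator (hX.prodMk hY hS))
  refine hint.trans (.of_forall fun x => ?_)
  exact integral_indicator_one (measurable_prodMk_left hS)

theorem exists_condLaw {β E : Type*} [MeasurableSpace β] [MeasurableSpace E]
    [StandardBorelSpace E] [Nonempty E] (h𝒢 : 𝒢 ≤ m₀) {Z : Ω → β} (hZ : Measurable[𝒢] Z)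
    {Y : Ω → E} (hY : Measurable Y) :
    ∃ κ : Ω → Measure E, (∀ x, IsProbabilityMeasure (κ x)) ∧ ∀ S : Set (β × E), MeasurableSet S →
      P⟦(fun x => (Z x, Y x)) ⁻¹' S | 𝒢⟧ =ᵐ[P] fun x => (κ x).real {r | (Z x, r) ∈ S} := by
  -- Conditioning on `𝒢` is conditioning on the identity map into the measurable space `(Ω, 𝒢)`.
  refine ⟨fun x => @condDistrib Ω Ω E _ _ _ m₀ 𝒢 Y id P _ x, fun x => ?_, fun S hS => ?_⟩
  · exact @IsMarkovKernel.is_probability_measure' _ _ 𝒢 _ _ _ x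
  · have hfst : Measurable[𝒢.prod inferInstance] fun p : Ω × E => Z p.1 :=
      hZ.comp (@measurable_fst Ω E 𝒢 inferInstance)
    have hsnd : Measurable[𝒢.prod inferInstance] (Prod.snd : Ω × E → E) :=
      @measurable_snd Ω E 𝒢 inferInstance
    have hpair : Measurable[𝒢.prod inferInstance] fun p : Ω × E => (Z p.1, p.2) := hfst.prodMk hsnd
    have hlaw := @condProb_preimage_ae_eq_condDistrib Ω m₀ P _ Ω E 𝒢 _ _ _ id Y
      (measurable_id'' h𝒢) hY _ (hpair hS)
    rw [MeasurableSpace.comap_id] at hlaw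
    exact hlaw

end ConditionalProbability

section Endpoint

variable {Ω : Type*} {𝒢 m₀ : MeasurableSpace Ω} {P : Measure Ω} [IsFiniteMeasure P]
  {X : Ω → ℝ} {γ : Ω → EReal}

theorem IsCondRightEndpoint.ae_le (hγ : IsCondRightEndpoint P X 𝒢 γ) (hX : Measurable X) :
    ∀ᵐ x ∂P, (X x : EReal) ≤ γ x :=
  (condProb_ae_eq_one_iff hγ.sub_field
    (measurableSet_le hX.coe_real_ereal (hγ.measurable.mono hγ.sub_field le_rfl))).1 hγ.le_endpoint

theorem IsCondRightEndpoint.ae_le_of_ae_le (hγ : IsCondRightEndpoint P X 𝒢 γ) (hX : Measurable X)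
    {g : Ω → EReal} (hg : Measurable[𝒢] g) (hXg : ∀ᵐ x ∂P, (X x : EReal) ≤ g x) : γ ≤ᵐ[P] g :=
  hγ.least g hg ((condProb_ae_eq_one_iff hγ.sub_field
    (measurableSet_le hX.coe_real_ereal (hg.mono hγ.sub_field le_rfl))).2 hXg)

theorem IsCondRightEndpoint.ae_condProb_gt_pos (hγ : IsCondRightEndpoint P X 𝒢 γ)
    (hX : Measurable X) {c : Ω → EReal} (hc : Measurable[𝒢] c) :
    ∀ᵐ x ∂P, c x < γ x → 0 < (P⟦{x | c x < X x} | 𝒢⟧) x := by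
  classical
  -- Where `c` is not exceeded with positive conditional probability, it is itself an upper bound.
  set N : Set Ω := {x | (P⟦{x | c x < X x} | 𝒢⟧) x ≤ 0}
  have hN : MeasurableSet[𝒢] N :=
    @measurableSet_le _ _ _ _ _ 𝒢 _ _ _ _ _ stronglyMeasurable_condExp.measurable
      measurable_const
  have hXg : ∀ᵐ x ∂P, (X x : EReal) ≤ N.piecewise c γ x := by
    filter_upwards [hγ.ae_le hX, ae_condProb_pos_of_mem hγ.sub_field
      (measurableSet_lt (hc.mono hγ.sub_field le_rfl) hX.coe_real_ereal)] with x hXγ hpos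
    by_cases hx : x ∈ N
    · rw [Set.piecewise_eq_of_mem _ _ _ hx]
      exact not_lt.1 fun hlt => (hpos hlt).not_ge hx
    · rwa [Set.piecewise_eq_of_notMem _ _ _ hx]
  filter_upwards [hγ.ae_le_of_ae_le hX (hc.piecewise hN hγ.measurable) hXg] with x hγg hcγ
  by_contra! hx
  rw [Set.piecewise_eq_of_mem _ _ _ (show x ∈ N from hx)] at hγg
  exact hγg.not_gt hcγ

end Endpoint

section Frequencies

variable {Ω : Type*} {𝒢 m₀ : MeasurableSpace Ω} {P : Measure Ω} [IsFiniteMeasure P] {T : Ω → Ω}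

theorem ae_tendsto_visitFreq_condProb (hT : MeasurePreserving T P P) (h𝒢 : 𝒢 ≤ m₀)
    (hle : MeasurableSpace.invariants T ≤ 𝒢)
    (hinv : ∀ A, MeasurableSet[𝒢] A → T ⁻¹' A =ᵐ[P] A) {Y : Ω → ℝ} (hY : Measurable Y)
    {s : Set ℝ} (hs : MeasurableSet s) :
    ∀ᵐ x ∂P, Tendsto (visitFreq (fun i => Y (T^[i] x)) s) atTop (𝓝 ((P⟦Y ⁻¹' s | 𝒢⟧) x)) := by
  filter_upwards [ae_tendsto_birkhoffAverage_condExp hT h𝒢 hle hinv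
    ((integrable_const (1 : ℝ)).indicator (hY hs))] with x hx
  exact hx.congr fun n => birkhoffAverage_indicator_eq_visitFreq T Y s n x

end Frequencies

theorem invariants_shift_le_almostInvariant (Q : Measure (ℕ → ℝ)) :
    MeasurableSpace.invariants shift ≤ almostInvariant Q := by
  intro A hA
  obtain ⟨hAm, hAT⟩ := MeasurableSpace.measurableSet_invariants.1 hA
  exact ⟨hAm, by simp [hAT]⟩

theorem preimage_shift_ae_eq {Q : Measure (ℕ → ℝ)} {A : Set (ℕ → ℝ)}
    (hA : MeasurableSet[almostInvariant Q] A) : shift ⁻¹' A =ᵐ[Q] A :=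
  ae_eq_set.2 (measure_union_null_iff.1 hA.2).symm

end NearMax

open NearMax in
theorem theorem3p1_general {Ω : Type*} {𝒢 m₀ : MeasurableSpace Ω} (P : Measure Ω)
    [IsFiniteMeasure P] {T : Ω → Ω} (hT : MeasurePreserving T P P)
    (hle : MeasurableSpace.invariants T ≤ 𝒢)
    (hinv : ∀ A, MeasurableSet[𝒢] A → T ⁻¹' A =ᵐ[P] A) {Y : Ω → ℝ} (hY : Measurable Y)
    {k : ℕ → ℕ} (hk : ∀ᶠ n in atTop, 1 ≤ k n ∧ k n ≤ n)
    (hk_lim : Tendsto (fun n => (k n : ℝ) / n) atTop (𝓝 1)) (a : ℝ) {γ : Ω → EReal}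
    (hγ : IsCondRightEndpoint P Y 𝒢 γ) (h_end : P {x | (Y x : EReal) = γ x} = 0)
    (h_end_sub : P {x | (Y x : EReal) = γ x - a} = 0) :
    ∀ᵐ x ∂P, Tendsto (fun n => nearCount (fun i => Y (T^[i] x)) (k n) n a / n) atTop
      (𝓝 ((P⟦{x | γ x - a < Y x} | 𝒢⟧) x)) := by
  have h𝒢 := hγ.sub_field
  obtain ⟨κ, hκ, hlaw⟩ := exists_condLaw (P := P) h𝒢 hγ.measurable hY
  have hnull {S : Set (EReal × ℝ)} (hS : MeasurableSet S) (hPS : P {x | (γ x, Y x) ∈ S} = 0) :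
      ∀ᵐ x ∂P, κ x {r | (γ x, r) ∈ S} = 0 := by
    filter_upwards [hlaw S hS, condProb_ae_eq_zero h𝒢 hPS] with x hx hx0
    exact (measureReal_eq_zero_iff (measure_ne_top (κ x) _)).1 (hx.symm.trans hx0)
  have hfst : Measurable fun p : EReal × ℝ => p.1 - a := by fun_prop
  have hsnd : Measurable fun p : EReal × ℝ => (p.2 : EReal) := measurable_snd.coe_real_ereal
  have hge : P {x | γ x ≤ Y x} = 0 := by
    refine measure_mono_null_ae ?_ h_end
    filter_upwards [hγ.ae_le hY] with x hx hx'
    exact hx.antisymm hx'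
  filter_upwards [
    ae_all_iff.2 fun n => (hT.iterate n).quasiMeasurePreserving.ae (hγ.ae_le hY),
    ae_forall_iterate_eq hT hinv hγ.measurable,
    ae_all_iff.2 fun q : ℚ =>
      hlaw {p | (q : ℝ) < p.2} (measurableSet_lt measurable_const measurable_snd),
    ae_all_iff.2 fun q : ℚ =>
      ae_tendsto_visitFreq_condProb hT h𝒢 hle hinv hY (measurableSet_Ioi (a := (q : ℝ))),
    ae_all_iff.2 fun q : ℚ => hγ.ae_condProb_gt_pos hY (c := fun _ => (q : ℝ)) measurable_const,
    hnull (measurableSet_le measurable_fst hsnd) hge,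
    hnull (measurableSet_eq_fun hsnd hfst) h_end_sub,
    hlaw _ (measurableSet_lt hfst hsnd)] with x hY_le hγT hlaw_Ioi hfreq hpos hz hza hlim
  have hlaw_Ioi (q : ℚ) : (P⟦Y ⁻¹' Set.Ioi (q : ℝ) | 𝒢⟧) x = (κ x).real (Set.Ioi (q : ℝ)) :=
    hlaw_Ioi q
  refine (tendsto_nearCount_div hk hk_lim (fun n => hγT n ▸ hY_le n) (fun q => ?_)
    (fun q hq => ?_) hz hza).trans_eq ?_
  · exact hlaw_Ioi q ▸ hfreq q
  · have := hpos q hq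
    simp only [EReal.coe_lt_coe_iff] at this
    exact hlaw_Ioi q ▸ this
  · exact congrArg 𝓝 hlim.symm

theorem theorem3p1 (Q : Measure (ℕ → ℝ)) [IsProbabilityMeasure Q]
    (hQ : MeasurePreserving NearMax.shift Q Q)
    (Y : (ℕ → ℝ) → ℝ) (hY : Measurable Y)
    (k : ℕ → ℕ) (hk : ∀ n, 1 ≤ n → 1 ≤ k n ∧ k n ≤ n)
    (hk_lim : Tendsto (fun n => (k n : ℝ) / (n : ℝ)) atTop (𝓝 1))
    (a : ℝ) (ha : 0 < a)
    (γ : (ℕ → ℝ) → EReal)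
    (hγ : NearMax.IsCondRightEndpoint Q Y (NearMax.almostInvariant Q) γ)
    (h_end : Q {x | (Y x : EReal) = γ x} = 0)
    (h_end_sub : Q {x | (Y x : EReal) = γ x - (a : EReal)} = 0) :
    ∀ᵐ x ∂Q, Tendsto
      (fun n : ℕ => NearMax.nearCount (NearMax.shiftSeq Y x) (k n) n a / (n : ℝ)) atTop
      (𝓝 ((Q⟦{x | γ x - (a : EReal) < (Y x : EReal)} | NearMax.almostInvariant Q⟧) x)) :=
  theorem3p1_general Q hQ (NearMax.invariants_shift_le_almostInvariant Q)
    (fun _ => NearMax.preimage_shift_ae_eq) hY (eventually_atTop.2 ⟨1, hk⟩) hk_lim a hγ h_end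
    h_end_sub
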